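/- An instance of the problem \textsc{IncMax} is a countable (finite or infinite) set $U$ together with a monotone function $f\colon 2^U\to\mathbb{R}_{\ge 0}$ that is accountable, i.e., every nonempty $X\subseteq U$ contains an element $e$ with $f(X\setminus\{e\})\ge f(X)-f(X)/|X|$ (where $f(X)/|X|:=0$ for infinite $X$), and such that for every integer $k$ with $1\le k\le |U|$ the maximum $\mathrm{Opt}(k)=\max\{f(X) : X\subseteq U,\ |X|=k\}$ exists. A (deterministic) solution is an order $\sigma=(e_1,e_2,\dots)$ of all elements of $U$; it is $\alpha$-competitive if $\mathrm{Opt}(k)\le\alpha\, f(\{e_1,\dots,e_k\})$ for every integer $k$ with $1\le k\le|U|$. A deterministic algorithm assigns a solution to every instance; it is $\alpha$-competitive if all these solutions are $\alpha$-competitive, and its competitive ratio is the infimum of all $\alpha\ge1$ for which it is $\alpha$-competitive ($\infty$ if there is none). The deterministic competitive ratio of \textsc{IncMax} is the infimum of the competitive ratios of all deterministic algorithms. \textbf{Theorem.} The equation $-4\rho^{6}+24\rho^{4}-\rho^{3}-30\rho^{2}+31\rho-4=0$ has exactly one real solution $\rho^*\ge1$; it satisfies $\rho^*\ge 2.246$,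 and the deterministic competitive ratio of \textsc{IncMax} is at least $\rho^*$. In particular, it is at least $2.246$. -/

import Mathlib

open scoped NNReal

namespace IncMax

/-- A function `f : 2^U → ℝ≥0` is accountable if every nonempty `X` contains an element `e` with
`f(X \ {e}) ≥ f(X) - f(X) / |X|`. For infinite `X` the quotient `f(X) / |X|` is `0`
(`Set.ncard` is then `0`, and so is the quotient). -/
def Accountable {U : Type} (f : Set U → ℝ≥0) : Prop :=
  ∀ X : Set U, X.Nonempty →
    ∃ e ∈ X, (f X : ℝ) - (f X : ℝ) / (X.ncard : ℝ) ≤ (f (X \ {e}) : ℝ)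

/-- An instance of the incremental maximization problem: a countable (finite or infinite) ground
set with a monotone and accountable objective function, such that for every cardinality `k` the
maximum of the objective over the sets of cardinality `k` exists (automatic if `U` is finite). -/
structure Instance where
  U : Type
  countable_U : Countable U
  f : Set U → ℝ≥0
  monotone_f : Monotone f
  accountable_f : Accountable f
  exists_max : ∀ k : ℕ, (k : ℕ∞) ≤ ENat.card U →
    ∃ X : Set U, X.encard = k ∧ ∀ Y : Set U, Y.encard = k → f Y ≤ f X

/-- `Opt(k) = max {f(X) : |X| = k, X ⊆ U}`. The maximum exists for `k ≤ |U|`, see `isGreatest_opt`;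
the value is not used for other `k`. -/
noncomputable def Instance.opt (I : Instance) (k : ℕ) : ℝ≥0 :=
  sSup {y | ∃ X : Set I.U, X.encard = k ∧ I.f X = y}

theorem Instance.isGreatest_opt (I : Instance) (k : ℕ) (hk : (k : ℕ∞) ≤ ENat.card I.U) :
    IsGreatest {y | ∃ X : Set I.U, X.encard = k ∧ I.f X = y} (I.opt k) := by
  obtain ⟨X, hX, hmax⟩ := I.exists_max k hk
  have h : IsGreatest {y | ∃ X : Set I.U, X.encard = k ∧ I.f X = y} (I.f X) := by
    refine ⟨⟨X, hX, rfl⟩, ?_⟩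
    rintro y ⟨Y, hY, rfl⟩
    exact hmax Y hY
  have h2 : I.opt k = I.f X := h.csSup_eq
  rw [h2]
  exact h

/-- A deterministic solution: an order `(e₁, e₂, …)` of all elements of `U`, indexed (from `0`)
by the natural numbers smaller than `|U|`. -/
abbrev Solution (U : Type) : Type := {i : ℕ // (i : ℕ∞) < ENat.card U} ≃ U

/-- The set `{e₁, …, eₖ}` of the first `k` elements of a solution. -/
def Solution.pre {U : Type} (σ : Solution U) (k : ℕ) : Set U :=
  {x | (σ.symm x).1 < k}

/-- A solution is `α`-competitive if `Opt(k) / f({e₁, …, eₖ}) ≤ α` for all `1 ≤ k ≤ |U|`; written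
without a division, so that `f({e₁, …, eₖ}) = 0` is allowed only if `Opt(k) = 0`. -/
def Solution.IsCompetitive (I : Instance) (σ : Solution I.U) (α : ℝ) : Prop :=
  ∀ k : ℕ, 1 ≤ k → (k : ℕ∞) ≤ ENat.card I.U → (I.opt k : ℝ) ≤ α * (I.f (σ.pre k) : ℝ)

/-- A deterministic algorithm assigns a solution to every instance. -/
abbrev Algorithm : Type 1 := (I : Instance) → Solution I.U

/-- An algorithm is `α`-competitive if it produces an `α`-competitive solution on every instance. -/
def Algorithm.IsCompetitive (A : Algorithm) (α : ℝ) : Prop :=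
  ∀ I : Instance, Solution.IsCompetitive I (A I) α

/-- The competitive ratio of an algorithm: the infimum over all `α ≥ 1` such that the algorithm is
`α`-competitive (`⊤` if there is none). -/
noncomputable def Algorithm.competitiveRatio (A : Algorithm) : EReal :=
  sInf {x | ∃ α : ℝ, 1 ≤ α ∧ A.IsCompetitive α ∧ x = (α : EReal)}

/-- The deterministic competitive ratio of the incremental maximization problem: the infimum of the
competitive ratios of all deterministic algorithms. -/
noncomputable def competitiveRatio : EReal :=
  ⨅ A : Algorithm, Algorithm.competitiveRatio A

end IncMax

/-!
Fix `1 ≤ α < κ < ρ*`. The hard instance consists of disjoint blocks, and the value of a set is the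
value of its best single block. Up to scaling, the `i`-th block has total value `κ ^ i` and size
`r i * κ ^ i`, where the inverse densities `r i` increase. As long as its value `u` is at most
`κ ^ (i - 1)`, an `α`-competitive solution competes with the optimum inside block `i`, so that it
has at most `α * u * r i` elements. A block can become best only after it has been filled up to the
current value, which costs elements, too. The sizes are chosen such that a solution has to fill a
`κ`-th part of block `i` before it leaves this block, and then has to continue with block `i + 1`,
because it cannot afford the `u * r (i + 2)` elements of a later block. The elements of the blocks
`0, …, i - 1` are wasted by then. As soon as the `r i` cease to increase, there is no block left with
which the solution could continue.

If the `r i` increased forever, then the sizes would be positive solutions of a linear recurrence,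
and log-concave, so that the quotients of consecutive sizes would converge to a zero `≥ κ` of the
characteristic polynomial. This is a cubic with a zero in `[0, 1]` and with the discriminant
`-κ * sextic κ`, which is negative for `κ < ρ*`, so it has no second real zero.
-/

open Filter Topology

namespace IncMax

/-! ### The sextic and the cubic whose discriminant it gives -/

/-- The polynomial whose unique zero in `[1, ∞)` is the lower bound `ρ*`. -/
def sextic (x : ℝ) : ℝ := -4 * x ^ 6 + 24 * x ^ 4 - x ^ 3 - 30 * x ^ 2 + 31 * x - 4

theorem sextic_pos_of_lt {x z : ℝ} (hx : 1 ≤ x) (hxz : x < z) (hz : 0 ≤ sextic z) :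
    0 < sextic x := by
  -- The coefficients of `sextic (1 + y) = 16 + 40 y + 51 y² + 15 y³ - 36 y⁴ - 24 y⁵ - 4 y⁶` change
  -- sign once, so that `sextic (1 + y) / y ^ 4` decreases in `y`.
  obtain ⟨y, rfl⟩ : ∃ y, x = 1 + y := ⟨x - 1, by ring⟩
  obtain ⟨w, rfl⟩ : ∃ w, z = 1 + w := ⟨z - 1, by ring⟩
  have hy : 0 ≤ y := by linarith
  have hyw : y < w := by linarith
  have hw : 0 < w := by linarith
  have cross : w ^ 4 * sextic (1 + y) = y ^ 4 * sextic (1 + w) + 16 * (w ^ 4 - y ^ 4)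
      + 40 * (y * w) * (w ^ 3 - y ^ 3) + 51 * (y * w) ^ 2 * (w ^ 2 - y ^ 2)
      + 15 * (y * w) ^ 3 * (w - y) + 24 * (y * w) ^ 4 * (w - y)
      + 4 * (y * w) ^ 4 * (w ^ 2 - y ^ 2) := by
    unfold sextic
    ring
  have : 0 < w - y := sub_pos.2 hyw
  have : 0 < w ^ 2 - y ^ 2 := sub_pos.2 (by gcongr)
  have : 0 < w ^ 3 - y ^ 3 := sub_pos.2 (by gcongr)
  have : 0 < w ^ 4 - y ^ 4 := sub_pos.2 (by gcongr)
  refine pos_of_mul_pos_right (a := w ^ 4) ?_ (by positivity)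
  rw [cross]
  positivity

theorem sextic_root_unique {x y : ℝ} (hx : 1 ≤ x) (hy : 1 ≤ y) (hx0 : sextic x = 0)
    (hy0 : sextic y = 0) : x = y := by
  rcases lt_trichotomy x y with h | h | h
  · exact absurd hx0 (sextic_pos_of_lt hx h hy0.ge).ne'
  · exact h
  · exact absurd hy0 (sextic_pos_of_lt hy h hx0.ge).ne'

theorem exists_sextic_root : ∃ ρ : ℝ, 2.246 ≤ ρ ∧ sextic ρ = 0 := by
  have hcont : ContinuousOn sextic (Set.Icc 2.246 2.247) := by
    unfold sextic
    fun_prop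
  obtain ⟨ρ, hρ, h0⟩ := intermediate_value_Icc' (by norm_num) hcont
    (show (0 : ℝ) ∈ _ by constructor <;> norm_num [sextic])
  exact ⟨ρ, hρ.1, h0⟩

theorem cubic_discr_eq_sq_of_isRoot {R : Type*} [CommRing R] [IsDomain R] {P : Cubic R} {x y : R}
    (hxy : x ≠ y) (hx : P.toPoly.IsRoot x) (hy : P.toPoly.IsRoot y) :
    P.discr = ((x - y) * (P.a * (x + 2 * y) + P.b) * (P.a * (2 * x + y) + P.b)) ^ 2 := by
  simp only [Cubic.toPoly, Polynomial.IsRoot.def, Polynomial.eval_add, Polynomial.eval_mul,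
    Polynomial.eval_pow, Polynomial.eval_C, Polynomial.eval_X] at hx hy
  have hc : P.c = -(P.a * (x ^ 2 + x * y + y ^ 2) + P.b * (x + y)) := by
    refine mul_left_cancel₀ (sub_ne_zero.2 hxy) ?_
    linear_combination hx - hy
  have hd : P.d = -(P.a * x ^ 3 + P.b * x ^ 2 + P.c * x) := by linear_combination hx
  rw [Cubic.discr, hd, hc]
  ring

/-- The characteristic polynomial of the recurrence `size_add_three` of the block sizes. -/
def charCubic (κ : ℝ) : Cubic ℝ := ⟨1, -(1 + κ ^ 2), 2 * κ ^ 2, κ - κ ^ 2⟩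

theorem isRoot_charCubic_iff {κ x : ℝ} : (charCubic κ).toPoly.IsRoot x ↔
    x ^ 3 - (1 + κ ^ 2) * x ^ 2 + 2 * κ ^ 2 * x + (κ - κ ^ 2) = 0 := by
  simp only [charCubic, Cubic.toPoly, Polynomial.IsRoot.def, Polynomial.eval_add,
    Polynomial.eval_mul, Polynomial.eval_pow, Polynomial.eval_C, Polynomial.eval_X]
  ring_nf

theorem discr_charCubic (κ : ℝ) : (charCubic κ).discr = -(κ * sextic κ) := by
  simp only [charCubic, Cubic.discr, sextic]
  ring

theorem not_isRoot_charCubic {κ q : ℝ} (hκ : 1 < κ) (hpos : 0 < sextic κ) (hq : 1 < q) :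
    ¬ (charCubic κ).toPoly.IsRoot q := by
  -- The cubic has a zero in `[0, 1]`; a second real zero would make its discriminant a square.
  intro hroot
  obtain ⟨x, hx, hx0⟩ := intermediate_value_Icc zero_le_one
    (f := fun x : ℝ => x ^ 3 - (1 + κ ^ 2) * x ^ 2 + 2 * κ ^ 2 * x + (κ - κ ^ 2)) (by fun_prop)
    (show (0 : ℝ) ∈ _ by constructor <;> nlinarith)
  have hsq := cubic_discr_eq_sq_of_isRoot (hx.2.trans_lt hq).ne
    (isRoot_charCubic_iff.2 hx0) hroot
  have hneg : (charCubic κ).discr < 0 := by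
    rw [discr_charCubic, neg_lt_zero]
    positivity
  exact absurd hneg (hsq ▸ (sq_nonneg _).not_gt)

/-! ### Block sizes and densities -/

/-- The sizes of the blocks of the hard instance, up to the scaling factor `N` and rounding. The
recurrence makes the two sides of `mul_invDensity_succ_lt` equal, up to the summand `-1`, if `α = κ`
and `u = N * κ ^ j`. -/
noncomputable def size (κ : ℝ) : ℕ → ℝ
  | 0 => 1
  | 1 => κ ^ 2
  | i + 2 => κ ^ 2 * (size κ (i + 1) - size κ i) - κ * ∑ l : Fin i, size κ l

theorem size_zero (κ : ℝ) : size κ 0 = 1 := by rw [size]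

theorem size_one (κ : ℝ) : size κ 1 = κ ^ 2 := by rw [size]

theorem size_add_two (κ : ℝ) (i : ℕ) : size κ (i + 2) =
    κ ^ 2 * (size κ (i + 1) - size κ i) - κ * ∑ l ∈ Finset.range i, size κ l := by
  rw [size, Fin.sum_univ_eq_sum_range]

theorem size_add_three (κ : ℝ) (i : ℕ) : size κ (i + 3) =
    (1 + κ ^ 2) * size κ (i + 2) - 2 * κ ^ 2 * size κ (i + 1) + (κ ^ 2 - κ) * size κ i := by
  have h := size_add_two κ (i + 1)
  rw [Finset.sum_range_succ] at h
  linear_combination h - size_add_two κ i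

theorem mul_le_mul_of_mul_le_sq {S T a b c : ℝ} (ha : 0 < a) (hb : 0 ≤ b) (hS : 0 ≤ S)
    (hac : a * c ≤ b ^ 2) (hST : S * b ≤ T * a) : S * c ≤ T * b := by
  refine le_of_mul_le_mul_right ?_ ha
  calc S * c * a = S * (a * c) := by ring
    _ ≤ S * b ^ 2 := by gcongr
    _ = S * b * b := by ring
    _ ≤ T * a * b := by gcongr
    _ = T * b * a := by ring

/-- Log-concavity and the bound on the partial sums need each other in the induction. -/
theorem size_logConcave_and_sum_mul_le {κ : ℝ} (hκ : 0 ≤ κ) (hpos : ∀ i, 0 < size κ i) (i : ℕ) :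
    size κ i * size κ (i + 2) ≤ size κ (i + 1) ^ 2 ∧
      (∑ l ∈ Finset.range i, size κ l) * size κ (i + 1) ≤
        (∑ l ∈ Finset.range (i + 1), size κ l) * size κ i := by
  induction i with
  | zero =>
    simp only [size_add_two, zero_add, size_one, size_zero, Finset.range_zero, Finset.sum_empty,
      Finset.range_one, Finset.sum_singleton]
    constructor <;> nlinarith [sq_nonneg κ]
  | succ i ih =>
    obtain ⟨hconcave, hsum⟩ := ih
    have h0 := hpos i
    have h1 := (hpos (i + 1)).le
    have hS : 0 ≤ ∑ l ∈ Finset.range i, size κ l := Finset.sum_nonneg fun l _ => (hpos l).le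
    have hc := size_add_two κ i
    have hd := size_add_two κ (i + 1)
    rw [Finset.sum_range_succ _ (i + 1)]
    rw [Finset.sum_range_succ] at hd hsum ⊢
    set S := ∑ l ∈ Finset.range i, size κ l
    constructor
    · have hcross := mul_le_mul_of_mul_le_sq h0 h1 hS hconcave hsum
      linear_combination κ ^ 2 * hconcave + κ * hcross + size κ (i + 1) * hd - size κ (i + 2) * hc
    · exact mul_le_mul_of_mul_le_sq h0 h1 (by positivity) hconcave (by linarith)

theorem antitone_size_ratio {κ : ℝ} (hκ : 0 ≤ κ) (hpos : ∀ i, 0 < size κ i) :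
    Antitone fun i => size κ (i + 1) / size κ i :=
  antitone_nat_of_succ_le fun i => by
    rw [div_le_div_iff₀ (hpos _) (hpos _), ← sq, mul_comm]
    exact (size_logConcave_and_sum_mul_le hκ hpos i).1

theorem isRoot_charCubic_of_tendsto_size_ratio {κ Q : ℝ} (hpos : ∀ i, 0 < size κ i)
    (hQ : Tendsto (fun i => size κ (i + 1) / size κ i) atTop (𝓝 Q)) :
    (charCubic κ).toPoly.IsRoot Q := by
  set q : ℕ → ℝ := fun i => size κ (i + 1) / size κ i with hq
  have hQ1 : Tendsto (fun i => q (i + 1)) atTop (𝓝 Q) := (tendsto_add_atTop_iff_nat 1).2 hQ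
  have hQ2 : Tendsto (fun i => q (i + 2)) atTop (𝓝 Q) := (tendsto_add_atTop_iff_nat 2).2 hQ
  have hrec : ∀ i, q (i + 2) * q (i + 1) * q i - (1 + κ ^ 2) * (q (i + 1) * q i)
      + 2 * κ ^ 2 * q i + (κ - κ ^ 2) = 0 := by
    intro i
    have := (hpos i).ne'
    have := (hpos (i + 1)).ne'
    have := (hpos (i + 2)).ne'
    simp only [hq]
    field_simp
    rw [size_add_three]
    ring
  have hlim := ((((hQ2.mul hQ1).mul hQ).sub ((hQ1.mul hQ).const_mul (1 + κ ^ 2))).add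
    (hQ.const_mul (2 * κ ^ 2))).add_const (κ - κ ^ 2)
  rw [isRoot_charCubic_iff, tendsto_nhds_unique tendsto_const_nhds (hlim.congr hrec)]
  ring

/-- The inverse of the density of the `i`-th block. The whole block thus has value `κ ^ i`, up to
scaling and rounding. -/
noncomputable def invDensity (κ : ℝ) (i : ℕ) : ℝ := size κ i / κ ^ i

theorem pow_mul_invDensity {κ : ℝ} (hκ : κ ≠ 0) (i : ℕ) : κ ^ i * invDensity κ i = size κ i :=
  mul_div_cancel₀ _ (pow_ne_zero i hκ)

theorem invDensity_zero (κ : ℝ) : invDensity κ 0 = 1 := by simp [invDensity, size_zero]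

theorem invDensity_one (κ : ℝ) : invDensity κ 1 = κ := by
  rw [invDensity, size_one, pow_one, sq, mul_self_div_self]

theorem invDensity_add_two {κ : ℝ} (hκ : κ ≠ 0) (i : ℕ) : invDensity κ (i + 2) =
    κ * invDensity κ (i + 1) - invDensity κ i
      - (∑ l ∈ Finset.range i, size κ l) / κ ^ (i + 1) := by
  simp only [invDensity, size_add_two]
  field_simp
  ring

theorem not_monotone_invDensity {κ : ℝ} (hκ : 1 < κ) (hpos : 0 < sextic κ) :
    ¬ Monotone (invDensity κ) := by
  intro hmono
  have hκ0 : 0 < κ := zero_lt_one.trans hκ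
  have hsize : ∀ i, 0 < size κ i := fun i => by
    have : 0 < invDensity κ i :=
      zero_lt_one.trans_le (invDensity_zero κ ▸ hmono (Nat.zero_le i))
    rw [← pow_mul_invDensity hκ0.ne']
    positivity
  have hratio : ∀ i, κ ≤ size κ (i + 1) / size κ i := fun i => by
    rw [le_div_iff₀ (hsize i), ← pow_mul_invDensity hκ0.ne', ← pow_mul_invDensity hκ0.ne',
      ← mul_assoc, ← pow_succ']
    have := hmono (Nat.le_succ i)
    gcongr
  have hlim := tendsto_atTop_ciInf (antitone_size_ratio hκ0.le hsize)
    ⟨κ, Set.forall_mem_range.2 hratio⟩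
  exact not_isRoot_charCubic hκ hpos (hκ.trans_le (ge_of_tendsto' hlim hratio))
    (isRoot_charCubic_of_tendsto_size_ratio hsize hlim)

/-- The inverse densities grow up to the block `M + 1` and then drop for the first time. -/
structure IsFirstDrop (κ : ℝ) (M : ℕ) : Prop where
  monotoneOn : MonotoneOn (invDensity κ) (Set.Iic (M + 1))
  drop : invDensity κ (M + 2) < invDensity κ (M + 1)

theorem exists_isFirstDrop {κ : ℝ} (hκ : 1 < κ) (hpos : 0 < sextic κ) :
    ∃ M, IsFirstDrop κ M := by
  classical
  have hex : ∃ i, invDensity κ (i + 1) < invDensity κ i := by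
    by_contra! h
    exact not_monotone_invDensity hκ hpos (monotone_nat_of_le_succ h)
  have hne : Nat.find hex ≠ 0 := by
    rw [Ne, Nat.find_eq_zero, zero_add, invDensity_one, invDensity_zero]
    exact hκ.not_gt
  obtain ⟨M, hM⟩ := Nat.exists_eq_succ_of_ne_zero hne
  refine ⟨M, monotoneOn_of_le_add_one Set.ordConnected_Iic fun i _ _ hi => ?_, ?_⟩
  · exact not_lt.1 (Nat.find_min hex (hM ▸ Nat.lt_succ_of_le (Nat.le_of_succ_le_succ hi)))
  · have := Nat.find_spec hex
    rwa [hM] at this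

theorem IsFirstDrop.one_le_invDensity {κ : ℝ} {M i : ℕ} (h : IsFirstDrop κ M) (hi : i ≤ M + 1) :
    1 ≤ invDensity κ i :=
  invDensity_zero κ ▸ h.monotoneOn (Nat.zero_le (M + 1)) hi (Nat.zero_le i)

theorem IsFirstDrop.le_invDensity {κ : ℝ} {M i : ℕ} (h : IsFirstDrop κ M) (hi0 : 1 ≤ i)
    (hi : i ≤ M + 1) : κ ≤ invDensity κ i :=
  (invDensity_one κ).symm.trans_le (h.monotoneOn (Nat.le_add_left 1 M) hi hi0)

theorem IsFirstDrop.size_nonneg {κ : ℝ} {M i : ℕ} (h : IsFirstDrop κ M) (hκ : 0 < κ)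
    (hi : i ≤ M + 1) : 0 ≤ size κ i := by
  have := h.one_le_invDensity hi
  rw [← pow_mul_invDensity hκ.ne']
  positivity

/-- An `α`-competitive solution of value `u` has at most as many elements as the left-hand side. The
right-hand side is what it needs before a block as expensive as block `j + 2` can become best. -/
theorem mul_invDensity_succ_lt {κ α N u : ℝ} {j : ℕ} (hκ : 0 < κ) (hu : 1 < u * (κ - α))
    (huN : u ≤ N * κ ^ j) (hr : 1 ≤ invDensity κ (j + 1))
    (hS : 0 ≤ ∑ l ∈ Finset.range j, size κ l) :
    α * u * invDensity κ (j + 1) < N / κ * ∑ l ∈ Finset.range j, size κ l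
      + u * invDensity κ j + u * invDensity κ (j + 2) - 1 := by
  have hwaste : u * ((∑ l ∈ Finset.range j, size κ l) / κ ^ (j + 1)) ≤
      N / κ * ∑ l ∈ Finset.range j, size κ l := by
    calc u * ((∑ l ∈ Finset.range j, size κ l) / κ ^ (j + 1))
        ≤ N * κ ^ j * ((∑ l ∈ Finset.range j, size κ l) / κ ^ (j + 1)) := by gcongr
      _ = N / κ * ∑ l ∈ Finset.range j, size κ l := by rw [pow_succ]; field_simp
  have hgain : 1 < u * (κ - α) * invDensity κ (j + 1) := one_lt_mul_of_lt_of_le hu hr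
  rw [invDensity_add_two hκ.ne']
  linarith


/-! ### Prefixes of solutions -/

theorem Solution.pre_mono {U : Type} (σ : Solution U) : Monotone σ.pre :=
  fun _ _ h _ hx => lt_of_lt_of_le hx h

theorem Solution.ncard_pre {U : Type} (σ : Solution U) {k : ℕ} (hk : (k : ℕ∞) ≤ ENat.card U) :
    (σ.pre k).ncard = k := by
  have himage : σ.pre k = σ '' {i | i.1 < k} := by
    rw [Equiv.image_eq_preimage_symm]
    rfl
  have hval : Subtype.val '' {i : {i : ℕ // (i : ℕ∞) < ENat.card U} | i.1 < k} = Set.Iio k := by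
    ext i
    simp only [Set.mem_image, Set.mem_ofPred_eq, Subtype.exists, exists_and_left, exists_prop,
      exists_eq_right_right, Set.mem_Iio, and_iff_left_iff_imp]
    exact fun hi => lt_of_lt_of_le (by exact_mod_cast hi) hk
  rw [himage, Set.ncard_image_of_injective _ σ.injective,
    ← Set.ncard_image_of_injective _ Subtype.val_injective, hval, ← Finset.coe_Iio,
    Set.ncard_coe_finset, Nat.card_Iio]

theorem natCast_le_enatCard {U : Type} [Finite U] {T : ℕ} (hT : T ≤ Nat.card U) :
    (T : ℕ∞) ≤ ENat.card U := by
  rw [ENat.card_eq_coe_natCard]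
  exact_mod_cast hT

theorem Solution.pre_natCard {U : Type} [Finite U] (σ : Solution U) :
    σ.pre (Nat.card U) = Set.univ := by
  refine Set.eq_of_subset_of_ncard_le (Set.subset_univ _) ?_ (Set.toFinite _)
  rw [σ.ncard_pre (natCast_le_enatCard le_rfl), Set.ncard_univ]

/-! ### Disjoint blocks of constant density -/

/-- A ground set divided into disjoint blocks. A subset of the `i`-th block has value
`1 / cost i` per element, and only the blocks with an index in `blocks` can have a value. -/
structure BlockSystem (U ι : Type*) where
  index : U → ι
  cost : ι → ℝ≥0
  blocks : Finset ι

namespace BlockSystem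

variable {U : Type} {ι : Type*} (B : BlockSystem U ι)

/-- The number of elements of `X` in the `i`-th block. -/
noncomputable def count (X : Set U) (i : ι) : ℕ := (X ∩ B.index ⁻¹' {i}).ncard

/-- The value of `X`, that is, the value of the best single block restricted to `X`. -/
noncomputable def value (X : Set U) : ℝ≥0 := B.blocks.sup fun i => B.count X i / B.cost i

/-- The value of `X` is the value of its intersection with the `i`-th block. -/
def IsBest (X : Set U) (i : ι) : Prop := i ∈ B.blocks ∧ B.value X * B.cost i = B.count X i

variable {B} {X Y : Set U} {i : ι}

theorem count_div_cost_le_value (hi : i ∈ B.blocks) : B.count X i / B.cost i ≤ B.value X :=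
  Finset.le_sup (f := fun i => (B.count X i / B.cost i : ℝ≥0)) hi

theorem exists_isBest (hB : B.blocks.Nonempty) (hcost : ∀ i ∈ B.blocks, B.cost i ≠ 0)
    (X : Set U) : ∃ i, B.IsBest X i := by
  obtain ⟨i, hi, hX⟩ := Finset.exists_mem_eq_sup _ hB fun i => (B.count X i / B.cost i : ℝ≥0)
  exact ⟨i, hi, (eq_div_iff (hcost i hi)).1 hX⟩

section LastTime

variable [Preorder ι] {σ : Solution U}

variable (B σ) in
/-- `T` is the last time at which some block with an index of at most `i` is best. -/
def IsLastTime (i : ι) (T : ℕ) : Prop :=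
  IsGreatest {T | T ≤ Nat.card U ∧ ∃ l ≤ i, B.IsBest (σ.pre T) l} T

theorem exists_isLastTime {T : ℕ} (hT : T ≤ Nat.card U) (hi : B.IsBest (σ.pre T) i) :
    ∃ T', T ≤ T' ∧ B.IsLastTime σ i T' := by
  have hmem : T ∈ {T | T ≤ Nat.card U ∧ ∃ l ≤ i, B.IsBest (σ.pre T) l} := ⟨hT, i, le_rfl, hi⟩
  obtain ⟨T', hT'⟩ := BddAbove.exists_isGreatest_of_nonempty
    ⟨Nat.card U, fun _ h => h.1⟩ ⟨T, hmem⟩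
  exact ⟨T', hT'.2 hmem, hT'⟩

end LastTime

variable [Finite U]

theorem count_mono (i : ι) : Monotone fun X => B.count X i :=
  fun _ _ h => Set.ncard_le_ncard (Set.inter_subset_inter_left _ h) (Set.toFinite _)

theorem value_mono : Monotone B.value := fun _ _ h => Finset.sup_mono_fun fun i _ => by
  have := count_mono (B := B) i h
  gcongr

theorem sum_count_le_ncard (X : Set U) (A : Finset ι) : ∑ i ∈ A, B.count X i ≤ X.ncard := by
  classical
  have := Fintype.ofFinite U
  have hcount : ∀ i, B.count X i = (X.toFinset.filter (B.index · = i)).card := fun i => by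
    rw [count, ← Set.ncard_coe_finset]
    congr 1
    ext x
    simp
  rw [Finset.sum_congr rfl fun i _ => hcount i, Set.ncard_eq_toFinset_card',
    Finset.sum_card_fiberwise_eq_card_filter X.toFinset A B.index]
  exact Finset.card_filter_le _ _

theorem count_le_ncard (X : Set U) (i : ι) : B.count X i ≤ X.ncard :=
  Set.ncard_le_ncard Set.inter_subset_left (Set.toFinite _)

theorem accountable_value : Accountable B.value := by
  rintro X ⟨x, hx⟩
  rcases B.blocks.eq_empty_or_nonempty with hB | hB
  · exact ⟨x, hx, by simp [value, hB]⟩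
  obtain ⟨i, hi, hX⟩ := Finset.exists_mem_eq_sup _ hB fun i => (B.count X i / B.cost i : ℝ≥0)
  change B.value X = _ at hX
  have hle : ∀ e, (B.count (X \ {e}) i : ℝ) / B.cost i ≤ B.value (X \ {e}) := fun e => by
    exact_mod_cast count_div_cost_le_value (X := X \ {e}) hi
  by_cases hout : ∃ e ∈ X, e ∉ B.index ⁻¹' {i}
  · obtain ⟨e, he, hei⟩ := hout
    refine ⟨e, he, (sub_le_self _ (by positivity)).trans (le_trans (le_of_eq ?_) (hle e))⟩
    rw [hX, count, count, ← Set.inter_sdiff_right_comm,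
      Set.sdiff_singleton_eq_self fun h => hei h.2]
    push_cast
    rfl
  · have hin : X ⊆ B.index ⁻¹' {i} := fun e he => not_not.1 fun h => hout ⟨e, he, h⟩
    refine ⟨x, hx, le_trans (le_of_eq ?_) (hle x)⟩
    have hcard := Set.ncard_sdiff_singleton_add_one hx (Set.toFinite _)
    have hne : (X.ncard : ℝ) ≠ 0 := by rw [← hcard]; positivity
    rw [hX, count, count, Set.inter_eq_left.2 hin,
      Set.inter_eq_left.2 (Set.sdiff_subset.trans hin)]
    push_cast
    rw [div_right_comm, div_self hne, ← sub_div, ← hcard]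
    push_cast
    ring

variable (B) in
/-- The problem instance whose objective is the value of a block system. -/
noncomputable def toInstance : Instance where
  U := U
  countable_U := inferInstance
  f := B.value
  monotone_f := value_mono
  accountable_f := accountable_value
  exists_max k hk := by
    obtain ⟨X₀, -, hX₀⟩ := Set.exists_subset_encard_eq (s := (Set.univ : Set U))
      (k := (k : ℕ∞)) (hk.trans_eq (Set.encard_univ _).symm)
    exact Set.exists_max_image {X : Set U | X.encard = k} B.value (Set.toFinite _) ⟨X₀, hX₀⟩

theorem min_ncard_div_cost_le_opt (hi : i ∈ B.blocks) {k : ℕ} (hk : (k : ℕ∞) ≤ ENat.card U) :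
    (min k (B.index ⁻¹' {i}).ncard : ℕ) / B.cost i ≤ B.toInstance.opt k := by
  set R := B.index ⁻¹' {i}
  have hR : R.encard = R.ncard := (Set.Finite.cast_ncard_eq (Set.toFinite _)).symm
  obtain ⟨X, hX, hXR⟩ : ∃ X : Set U, X.encard = k ∧ min k R.ncard ≤ B.count X i := by
    rcases le_total k R.ncard with h | h
    · obtain ⟨X, hXR, hX⟩ := Set.exists_subset_encard_eq (s := R) (k := (k : ℕ∞))
        (by rw [hR]; exact_mod_cast h)
      have hXk : X.ncard = k := by rw [Set.ncard, hX, ENat.toNat_natCast]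
      refine ⟨X, hX, ?_⟩
      rw [count, Set.inter_eq_left.2 hXR, hXk]
      exact min_le_left _ _
    · obtain ⟨X, hRX, -, hX⟩ := Set.exists_superset_subset_encard_eq (Set.subset_univ R)
        (k := (k : ℕ∞)) (by rw [hR]; exact_mod_cast h) (by rwa [Set.encard_univ])
      refine ⟨X, hX, ?_⟩
      rw [count, Set.inter_eq_right.2 hRX]
      exact min_le_right _ _
  calc ((min k R.ncard : ℕ) / B.cost i : ℝ≥0) ≤ B.count X i / B.cost i := by gcongr
    _ ≤ B.value X := count_div_cost_le_value hi
    _ ≤ B.toInstance.opt k := (B.toInstance.isGreatest_opt k hk).2 ⟨X, hX, rfl⟩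

variable {σ : Solution U}

theorem min_ncard_le_of_isCompetitive {α : ℝ} (hσ : Solution.IsCompetitive B.toInstance σ α)
    (hi : i ∈ B.blocks) (hcost : B.cost i ≠ 0) {k : ℕ} (hk1 : 1 ≤ k)
    (hk : (k : ℕ∞) ≤ ENat.card U) :
    (min k (B.index ⁻¹' {i}).ncard : ℕ) ≤ α * B.value (σ.pre k) * B.cost i := by
  have hpos : (0 : ℝ) < B.cost i := NNReal.coe_pos.2 (pos_iff_ne_zero.2 hcost)
  have hopt : ((min k (B.index ⁻¹' {i}).ncard : ℕ) / B.cost i : ℝ) ≤ B.toInstance.opt k := by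
    exact_mod_cast min_ncard_div_cost_le_opt hi hk
  exact (div_le_iff₀ hpos).1 (hopt.trans (hσ k hk1 hk))

theorem count_pre_succ_le (σ : Solution U) (i : ι) (T : ℕ) :
    B.count (σ.pre (T + 1)) i ≤ B.count (σ.pre T) i + 1 := by
  have hnew : {x | (σ.symm x).1 = T}.ncard ≤ 1 :=
    Set.ncard_le_one_iff_subsingleton.2 fun x hx y hy =>
      σ.symm.injective (Subtype.ext (hx.trans hy.symm))
  have hsub : σ.pre (T + 1) ∩ B.index ⁻¹' {i} ⊆
      (σ.pre T ∩ B.index ⁻¹' {i}) ∪ {x | (σ.symm x).1 = T} := fun x hx =>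
    (Nat.lt_succ_iff_lt_or_eq.1 hx.1).imp (fun h => ⟨h, hx.2⟩) id
  calc B.count (σ.pre (T + 1)) i
      ≤ B.count (σ.pre T) i + {x | (σ.symm x).1 = T}.ncard :=
        (Set.ncard_le_ncard hsub (Set.toFinite _)).trans (Set.ncard_union_le _ _)
    _ ≤ B.count (σ.pre T) i + 1 := by gcongr

/-- Before it overtakes block `i`, block `k` is filled up to the value of block `i`, except for one
element. -/
theorem sum_count_add_le_of_isBest_succ {k : ι} {T : ℕ} {A : Finset ι} (hT : (T : ℕ∞) ≤ ENat.card U)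
    (hi : B.IsBest (σ.pre T) i) (hk : B.IsBest (σ.pre (T + 1)) k) (hik : i ≠ k) (hiA : i ∉ A)
    (hkA : k ∉ A) :
    ∑ l ∈ A, (B.count (σ.pre T) l : ℝ≥0) + B.value (σ.pre T) * B.cost i
      + B.value (σ.pre T) * B.cost k ≤ T + 1 := by
  classical
  have hsum : ∑ l ∈ A, B.count (σ.pre T) l + B.count (σ.pre T) i + B.count (σ.pre T) k ≤ T := by
    have h := (sum_count_le_ncard (B := B) (σ.pre T) (insert i (insert k A))).trans_eq
      (σ.ncard_pre hT)
    rw [Finset.sum_insert (by simp [hik, hiA]), Finset.sum_insert hkA] at h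
    omega
  have hvalue : B.value (σ.pre T) * B.cost k ≤ B.count (σ.pre T) k + 1 :=
    calc B.value (σ.pre T) * B.cost k ≤ B.value (σ.pre (T + 1)) * B.cost k := by
          have := value_mono (B := B) (σ.pre_mono T.le_succ)
          gcongr
      _ = B.count (σ.pre (T + 1)) k := hk.2
      _ ≤ B.count (σ.pre T) k + 1 := by exact_mod_cast count_pre_succ_le σ k T
  calc ∑ l ∈ A, (B.count (σ.pre T) l : ℝ≥0) + B.value (σ.pre T) * B.cost i
        + B.value (σ.pre T) * B.cost k
      ≤ ∑ l ∈ A, (B.count (σ.pre T) l : ℝ≥0) + B.count (σ.pre T) i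
        + (B.count (σ.pre T) k + 1) := by
        rw [hi.2]
        gcongr
    _ ≤ T + 1 := by
        rw [← add_assoc]
        gcongr
        exact_mod_cast hsum

end BlockSystem


/-! ### The hard instance -/

/-- The parameters (base `κ`, competitive ratio `α`, index `M + 1` of the last block, scaling
factor `N`) for which the hard instance has no `α`-competitive solution. The lower bound on `N`
makes up for the rounding of the block sizes. -/
structure IsHard (κ α : ℝ) (M N : ℕ) : Prop extends IsFirstDrop κ M where
  one_le_ratio : 1 ≤ α
  ratio_lt_base : α < κ
  base_lt_scale_mul : κ < N * (κ - α)

/-- The ground set of the hard instance, with the blocks `0, …, M + 1`. -/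
abbrev HardSet (κ : ℝ) (M N : ℕ) : Type := Σ j : Fin (M + 2), Fin ⌊N * size κ j⌋₊

/-- The blocks of the hard instance and their densities. -/
noncomputable def hardSystem (κ : ℝ) (M N : ℕ) : BlockSystem (HardSet κ M N) ℕ where
  index x := x.1
  cost i := (invDensity κ i).toNNReal
  blocks := Finset.range (M + 2)

section HardInstance

open BlockSystem

variable {κ α : ℝ} {M N i T : ℕ} {X : Set (HardSet κ M N)} {σ : Solution (HardSet κ M N)}

theorem mem_blocks_hardSystem : i ∈ (hardSystem κ M N).blocks ↔ i ≤ M + 1 :=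
  Finset.mem_range_succ_iff

theorem IsFirstDrop.coe_cost_hardSystem (h : IsFirstDrop κ M) (hi : i ≤ M + 1) :
    ((hardSystem κ M N).cost i : ℝ) = invDensity κ i :=
  Real.coe_toNNReal _ (zero_le_one.trans (h.one_le_invDensity hi))

theorem IsFirstDrop.cost_hardSystem_ne_zero (h : IsFirstDrop κ M) (hi : i ≤ M + 1) :
    (hardSystem κ M N).cost i ≠ 0 := by
  have := h.one_le_invDensity hi
  rw [← NNReal.coe_ne_zero, h.coe_cost_hardSystem hi]
  positivity

theorem IsFirstDrop.exists_isBest_hardSystem (h : IsFirstDrop κ M) (X : Set (HardSet κ M N)) :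
    ∃ i, (hardSystem κ M N).IsBest X i :=
  exists_isBest ⟨0, mem_blocks_hardSystem.2 (M + 1).zero_le⟩
    (fun _ hi => h.cost_hardSystem_ne_zero (mem_blocks_hardSystem.1 hi)) X

theorem ncard_preimage_index_hardSystem (hi : i ≤ M + 1) :
    ((hardSystem κ M N).index ⁻¹' {i}).ncard = ⌊N * size κ i⌋₊ := by
  have hrange : (hardSystem κ M N).index ⁻¹' {i} =
      Set.range (Sigma.mk (⟨i, Nat.lt_succ_of_le hi⟩ : Fin (M + 2))) := by
    ext ⟨j, x⟩
    simp [hardSystem, Fin.ext_iff, eq_comm]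
  rw [hrange, ← Set.image_univ, Set.ncard_image_of_injective _ sigma_mk_injective,
    Set.ncard_univ, Nat.card_fin]

theorem IsFirstDrop.value_mul_invDensity (h : IsFirstDrop κ M)
    (hX : (hardSystem κ M N).IsBest X i) :
    (hardSystem κ M N).value X * invDensity κ i = (hardSystem κ M N).count X i := by
  rw [← h.coe_cost_hardSystem (N := N) (mem_blocks_hardSystem.1 hX.1)]
  exact_mod_cast hX.2

namespace IsHard

variable (h : IsHard κ α M N)
include h

theorem one_lt_base : 1 < κ := h.one_le_ratio.trans_lt h.ratio_lt_base

theorem base_pos : 0 < κ := zero_lt_one.trans h.one_lt_base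

theorem scale_pos : 0 < N := by
  refine Nat.pos_of_ne_zero fun hN => absurd (h.base_pos.trans h.base_lt_scale_mul) ?_
  simp [hN]

theorem mul_pow_mul_invDensity_sub_one_lt (hi : i ≤ M + 1) :
    N * κ ^ i * invDensity κ i - 1 < ((hardSystem κ M N).index ⁻¹' {i}).ncard := by
  rw [ncard_preimage_index_hardSystem hi, mul_assoc, pow_mul_invDensity h.base_pos.ne']
  exact Nat.sub_one_lt_floor _

theorem value_le_of_isBest (hX : (hardSystem κ M N).IsBest X i) :
    (hardSystem κ M N).value X ≤ N * κ ^ i := by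
  have hi := mem_blocks_hardSystem.1 hX.1
  have hr := h.one_le_invDensity hi
  refine le_of_mul_le_mul_right ?_ (zero_lt_one.trans_le hr)
  calc (hardSystem κ M N).value X * invDensity κ i
      = (hardSystem κ M N).count X i := h.value_mul_invDensity hX
    _ ≤ ((hardSystem κ M N).index ⁻¹' {i}).ncard := by
        exact_mod_cast Set.ncard_le_ncard Set.inter_subset_right (Set.toFinite _)
    _ ≤ N * κ ^ i * invDensity κ i := by
        rw [ncard_preimage_index_hardSystem hi, mul_assoc, pow_mul_invDensity h.base_pos.ne']
        exact Nat.floor_le (mul_nonneg N.cast_nonneg (h.size_nonneg h.base_pos hi))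

theorem eq_of_isBest_univ (hi : (hardSystem κ M N).IsBest Set.univ i) : i = M + 1 := by
  by_contra hne
  have hiM : i ≤ M := by
    have := mem_blocks_hardSystem.1 hi.1
    omega
  have hr := h.one_le_invDensity le_rfl
  have hcard := h.mul_pow_mul_invDensity_sub_one_lt le_rfl
  have hlast : ((hardSystem κ M N).index ⁻¹' {M + 1}).ncard ≤
      (hardSystem κ M N).value Set.univ * invDensity κ (M + 1) := by
    rw [← div_le_iff₀ (by positivity), ← h.coe_cost_hardSystem (N := N) le_rfl,
      ← Set.univ_inter ((hardSystem κ M N).index ⁻¹' {M + 1})]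
    exact_mod_cast count_div_cost_le_value (X := Set.univ) (mem_blocks_hardSystem.2 le_rfl)
  have hvalue : ((hardSystem κ M N).value Set.univ : ℝ) ≤ N * κ ^ M :=
    (h.value_le_of_isBest hi).trans (by have := h.one_lt_base.le; gcongr)
  have hgain : 1 < N * (κ - 1) * κ ^ M * invDensity κ (M + 1) := by
    have hN : 1 < N * (κ - 1) := by
      linarith [h.base_lt_scale_mul, h.one_lt_base,
        mul_le_mul_of_nonneg_left h.one_le_ratio N.cast_nonneg]
    exact one_lt_mul_of_lt_of_le (one_lt_mul_of_lt_of_le hN (one_le_pow₀ h.one_lt_base.le)) hr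
  have := mul_le_mul_of_nonneg_right hvalue (zero_le_one.trans hr)
  rw [pow_succ] at hcard
  linarith

/-- The optimum can take `T` elements from block `i`: if the block were smaller than that, then its
value, which is almost `N * κ ^ i`, would exceed `α` times the value of the solution. -/
theorem time_le_mul_invDensity (hσ : σ.IsCompetitive (hardSystem κ M N).toInstance α)
    (hT : T ≤ Nat.card (HardSet κ M N)) (hi : i ≤ M + 1)
    (hu : κ * (hardSystem κ M N).value (σ.pre T) ≤ N * κ ^ i) :
    T ≤ α * (hardSystem κ M N).value (σ.pre T) * invDensity κ i := by
  obtain ⟨u, hu_def⟩ : ∃ u : ℝ, u = (hardSystem κ M N).value (σ.pre T) := ⟨_, rfl⟩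
  have hu0 : 0 ≤ u := hu_def ▸ NNReal.coe_nonneg _
  rw [← hu_def] at hu ⊢
  have hr := h.one_le_invDensity hi
  have hα := h.one_le_ratio
  rcases T.eq_zero_or_pos with hT0 | hT0
  · rw [hT0, Nat.cast_zero]
    positivity
  have hmin := min_ncard_le_of_isCompetitive hσ (mem_blocks_hardSystem.2 hi)
    (h.cost_hardSystem_ne_zero hi) hT0 (natCast_le_enatCard hT)
  rw [h.coe_cost_hardSystem hi, ← hu_def] at hmin
  rcases min_choice T ((hardSystem κ M N).index ⁻¹' {i}).ncard with hc | hc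
  · rwa [hc] at hmin
  rw [hc] at hmin
  have hcard := h.mul_pow_mul_invDensity_sub_one_lt hi
  have hscaled : κ * (α * u * invDensity κ i) ≤ α * (N * κ ^ i * invDensity κ i) := by
    calc κ * (α * u * invDensity κ i) = α * (κ * u * invDensity κ i) := by ring
      _ ≤ α * (N * κ ^ i * invDensity κ i) := by gcongr
  have hgain : κ < N * (κ - α) * (κ ^ i * invDensity κ i) :=
    h.base_lt_scale_mul.trans_le <|
      le_mul_of_one_le_right (h.base_pos.trans h.base_lt_scale_mul).le <|
      one_le_mul_of_one_le_of_one_le (one_le_pow₀ h.one_lt_base.le) hr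
  have := mul_lt_mul_of_pos_left (hcard.trans_le hmin) h.base_pos
  linarith

theorem exists_isBest_succ (hσ : σ.IsCompetitive (hardSystem κ M N).toInstance α)
    (hT : (hardSystem κ M N).IsLastTime σ i T) (hi : (hardSystem κ M N).IsBest (σ.pre T) i)
    (hiM : i ≤ M) :
    T + 1 ≤ Nat.card (HardSet κ M N) ∧
    ∃ k, i < k ∧ k ≤ M + 1 ∧ (hardSystem κ M N).IsBest (σ.pre (T + 1)) k ∧
      ∀ j ≤ M + 1, κ * (hardSystem κ M N).value (σ.pre T) ≤ N * κ ^ j →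
        ∑ l ∈ Finset.range i, ((hardSystem κ M N).count (σ.pre T) l : ℝ)
          + (hardSystem κ M N).value (σ.pre T) * invDensity κ i
          + (hardSystem κ M N).value (σ.pre T) * invDensity κ k ≤
        α * (hardSystem κ M N).value (σ.pre T) * invDensity κ j + 1 := by
  have hTK : T + 1 ≤ Nat.card (HardSet κ M N) := by
    refine Nat.lt_of_le_of_ne hT.1.1 fun hTK => ?_
    rw [hTK, σ.pre_natCard] at hi
    have := h.eq_of_isBest_univ hi
    omega
  obtain ⟨k, hk⟩ := h.exists_isBest_hardSystem (σ.pre (T + 1))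
  have hkM := mem_blocks_hardSystem.1 hk.1
  have hik : i < k := by
    by_contra! hki
    exact absurd (hT.2 ⟨hTK, k, hki, hk⟩) (Nat.not_succ_le_self T)
  refine ⟨hTK, k, hik, hkM, hk, fun j hj hu => ?_⟩
  have hsum : ∑ l ∈ Finset.range i, ((hardSystem κ M N).count (σ.pre T) l : ℝ)
      + (hardSystem κ M N).value (σ.pre T) * (hardSystem κ M N).cost i
      + (hardSystem κ M N).value (σ.pre T) * (hardSystem κ M N).cost k ≤ T + 1 := by
    exact_mod_cast sum_count_add_le_of_isBest_succ (A := Finset.range i)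
      (natCast_le_enatCard hT.1.1) hi hk hik.ne (by simp) (by simpa using hik.le)
  rw [h.coe_cost_hardSystem (hiM.trans M.le_succ), h.coe_cost_hardSystem hkM] at hsum
  have htime := h.time_le_mul_invDensity hσ hT.1.1 hj hu
  linarith

theorem one_le_natCard : 1 ≤ Nat.card (HardSet κ M N) := by
  rw [← Set.ncard_univ]
  refine le_trans ?_ (Set.ncard_le_ncard
    (Set.subset_univ ((hardSystem κ M N).index ⁻¹' {0})) (Set.toFinite _))
  rw [ncard_preimage_index_hardSystem (M + 1).zero_le, size_zero, mul_one, Nat.floor_natCast]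
  exact h.scale_pos

theorem isBest_pre_one (hσ : σ.IsCompetitive (hardSystem κ M N).toInstance α) :
    (hardSystem κ M N).IsBest (σ.pre 1) 0 ∧ 1 ≤ (hardSystem κ M N).value (σ.pre 1) := by
  have hcard := natCast_le_enatCard h.one_le_natCard
  obtain ⟨i, hi⟩ := h.exists_isBest_hardSystem (σ.pre 1)
  have hvalue := h.value_mul_invDensity hi
  have hcomp : 1 ≤ α * (hardSystem κ M N).value (σ.pre 1) := by
    have := min_ncard_le_of_isCompetitive hσ (mem_blocks_hardSystem.2 (M + 1).zero_le)
      (h.cost_hardSystem_ne_zero (M + 1).zero_le) le_rfl hcard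
    rwa [ncard_preimage_index_hardSystem (M + 1).zero_le, size_zero, mul_one, Nat.floor_natCast,
      min_eq_left h.scale_pos, Nat.cast_one, h.coe_cost_hardSystem (M + 1).zero_le,
      invDensity_zero, mul_one] at this
  have hpos : (0 : ℝ) < (hardSystem κ M N).value (σ.pre 1) :=
    pos_of_mul_pos_right (zero_lt_one.trans_le hcomp) (zero_le_one.trans h.one_le_ratio)
  obtain rfl : i = 0 := by
    by_contra hi0
    have hcount : (hardSystem κ M N).count (σ.pre 1) i ≤ 1 :=
      (count_le_ncard _ _).trans_eq (σ.ncard_pre hcard)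
    have hr := h.le_invDensity (Nat.one_le_iff_ne_zero.2 hi0) (mem_blocks_hardSystem.1 hi.1)
    refine h.ratio_lt_base.not_ge (le_of_mul_le_mul_right ?_ hpos)
    calc κ * (hardSystem κ M N).value (σ.pre 1)
        ≤ (hardSystem κ M N).value (σ.pre 1) * invDensity κ i := by rw [mul_comm]; gcongr
      _ ≤ 1 := hvalue.trans_le (by exact_mod_cast hcount)
      _ ≤ α * (hardSystem κ M N).value (σ.pre 1) := hcomp
  rw [invDensity_zero, mul_one] at hvalue
  have hcount : 0 < (hardSystem κ M N).count (σ.pre 1) 0 := by exact_mod_cast hvalue ▸ hpos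
  refine ⟨hi, ?_⟩
  rw [← NNReal.coe_le_coe, hvalue]
  exact_mod_cast hcount

/-- The state of a solution at the last time `T` at which one of the blocks `0, …, i` is best: this
is block `i`, at least a `κ`-th part of which is filled, and the same holds for the blocks before it
taken together. -/
structure IsStage (κ : ℝ) (M N : ℕ) (σ : Solution (HardSet κ M N)) (i T : ℕ) : Prop where
  isLastTime : (hardSystem κ M N).IsLastTime σ i T
  isBest : (hardSystem κ M N).IsBest (σ.pre T) i
  le_sum_count : N / κ * ∑ l ∈ Finset.range i, size κ l ≤
    ∑ l ∈ Finset.range i, ((hardSystem κ M N).count (σ.pre T) l : ℝ)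
  le_value : N * κ ^ i ≤ κ * (hardSystem κ M N).value (σ.pre T)

theorem exists_isStage_zero (hσ : σ.IsCompetitive (hardSystem κ M N).toInstance α) :
    ∃ T, IsStage κ M N σ 0 T := by
  obtain ⟨hbest, hvalue⟩ := h.isBest_pre_one hσ
  obtain ⟨T, hT1, hT⟩ := exists_isLastTime h.one_le_natCard hbest
  obtain ⟨-, l, hl, hlast⟩ := hT.1
  obtain rfl : l = 0 := Nat.le_zero.1 hl
  have hu : (1 : ℝ) ≤ (hardSystem κ M N).value (σ.pre T) := by
    exact_mod_cast hvalue.trans (value_mono (σ.pre_mono hT1))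
  refine ⟨T, hT, hlast, by simp, ?_⟩
  by_contra! hlt
  obtain ⟨-, k, hk, hkM, -, hnext⟩ := h.exists_isBest_succ hσ hT hlast M.zero_le
  have hsum := hnext 0 (M + 1).zero_le hlt.le
  have hrk := h.le_invDensity hk hkM
  rw [Finset.sum_range_zero, zero_add, invDensity_zero] at hsum
  nlinarith [h.ratio_lt_base]

theorem one_lt_mul_sub {u : ℝ} (hu : N * κ ^ i ≤ κ * u) : 1 < u * (κ - α) := by
  have hα : 0 < κ - α := sub_pos.2 h.ratio_lt_base
  refine lt_of_mul_lt_mul_left ?_ h.base_pos.le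
  calc κ * 1 < N * (κ - α) := by rw [mul_one]; exact h.base_lt_scale_mul
    _ ≤ N * κ ^ i * (κ - α) := by
        have := le_mul_of_one_le_right N.cast_nonneg (one_le_pow₀ (n := i) h.one_lt_base.le)
        gcongr
    _ ≤ κ * u * (κ - α) := by gcongr
    _ = κ * (u * (κ - α)) := by ring

theorem sum_size_nonneg (hi : i ≤ M + 1) : 0 ≤ ∑ l ∈ Finset.range i, size κ l :=
  Finset.sum_nonneg fun _ hl => h.size_nonneg h.base_pos ((Finset.mem_range.1 hl).le.trans hi)

theorem exists_isBest_succ_of_isStage (hσ : σ.IsCompetitive (hardSystem κ M N).toInstance α)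
    (hs : IsStage κ M N σ i T) (hiM : i ≤ M) :
    T + 1 ≤ Nat.card (HardSet κ M N) ∧ ∃ k, i < k ∧ k ≤ M + 1 ∧
      (hardSystem κ M N).IsBest (σ.pre (T + 1)) k ∧ invDensity κ k < invDensity κ (i + 2) := by
  obtain ⟨hTK, k, hik, hkM, hk, hnext⟩ := h.exists_isBest_succ hσ hs.isLastTime hs.isBest hiM
  refine ⟨hTK, k, hik, hkM, hk, ?_⟩
  have hi1 : i + 1 ≤ M + 1 := Nat.succ_le_succ hiM
  have hu := h.one_lt_mul_sub hs.le_value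
  have huN := h.value_le_of_isBest hs.isBest
  have hsum := hnext (i + 1) hi1 (by
    rw [pow_succ']
    linarith [mul_le_mul_of_nonneg_left huN h.base_pos.le])
  have hlt := mul_invDensity_succ_lt h.base_pos hu huN (h.one_le_invDensity hi1)
    (h.sum_size_nonneg (hiM.trans M.le_succ))
  refine lt_of_mul_lt_mul_left ?_ ((hardSystem κ M N).value (σ.pre T)).coe_nonneg
  linarith [hs.le_sum_count]

theorem le_value_of_isLastTime_succ (hσ : σ.IsCompetitive (hardSystem κ M N).toInstance α)
    (hi : i + 1 ≤ M) (hT : (hardSystem κ M N).IsLastTime σ (i + 1) T)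
    (hbest : (hardSystem κ M N).IsBest (σ.pre T) (i + 1))
    (hsum : N / κ * ∑ l ∈ Finset.range (i + 1), size κ l ≤
      ∑ l ∈ Finset.range (i + 1), ((hardSystem κ M N).count (σ.pre T) l : ℝ))
    (hu : N * κ ^ i ≤ κ * (hardSystem κ M N).value (σ.pre T)) :
    N * κ ^ (i + 1) ≤ κ * (hardSystem κ M N).value (σ.pre T) := by
  by_contra! hlt
  have hκ := h.base_pos
  have hi1 : i + 1 ≤ M + 1 := hi.trans M.le_succ
  have hi0 : i ≤ M + 1 := Nat.le_of_succ_le hi1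
  obtain ⟨-, k, hik, hkM, -, hnext⟩ := h.exists_isBest_succ hσ hT hbest hi
  have hnext := hnext (i + 1) hi1 hlt.le
  obtain ⟨u, hu_def⟩ : ∃ u : ℝ, u = (hardSystem κ M N).value (σ.pre T) := ⟨_, rfl⟩
  have hu0 : 0 ≤ u := hu_def ▸ NNReal.coe_nonneg _
  rw [← hu_def] at hlt hu hnext
  have huN : u ≤ N * κ ^ i := by
    refine le_of_mul_le_mul_left (hlt.le.trans_eq ?_) hκ
    ring
  have hcap := mul_invDensity_succ_lt hκ (h.one_lt_mul_sub hu) huN (h.one_le_invDensity hi1)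
    (h.sum_size_nonneg hi0)
  have hri : u * invDensity κ i ≤ u * invDensity κ (i + 1) := by
    have := h.monotoneOn hi0 hi1 i.le_succ
    gcongr
  have hrk : u * invDensity κ (i + 2) ≤ u * invDensity κ k := by
    have := h.monotoneOn (Nat.le_trans hik hkM) hkM hik
    gcongr
  have hsize : 0 ≤ N / κ * size κ i := mul_nonneg (by positivity) (h.size_nonneg hκ hi0)
  rw [Finset.sum_range_succ _ i, mul_add] at hsum
  linarith

theorem exists_isStage_succ (hσ : σ.IsCompetitive (hardSystem κ M N).toInstance α)
    (hs : IsStage κ M N σ i T) (hiM : i + 1 ≤ M) : ∃ T', IsStage κ M N σ (i + 1) T' := by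
  have hκ := h.base_pos
  obtain ⟨hTK, k, hik, hkM, hk, hrk⟩ :=
    h.exists_isBest_succ_of_isStage hσ hs (Nat.le_of_succ_le hiM)
  obtain rfl : k = i + 1 := by
    by_contra hne
    have hik' : i + 2 ≤ k := by omega
    exact hrk.not_ge (h.monotoneOn (hik'.trans hkM) hkM hik')
  obtain ⟨T', hTT', hT'⟩ := exists_isLastTime hTK hk
  obtain ⟨hTK', l, hl, hbest⟩ := hT'.1
  obtain rfl : l = i + 1 := by
    by_contra hne
    exact absurd (hs.isLastTime.2 ⟨hTK', l, by omega, hbest⟩) (by omega)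
  have hpre : σ.pre T ⊆ σ.pre T' := σ.pre_mono (Nat.le_of_succ_le hTT')
  have hcount : ∀ l, ((hardSystem κ M N).count (σ.pre T) l : ℝ) ≤
      (hardSystem κ M N).count (σ.pre T') l := fun l => by exact_mod_cast count_mono l hpre
  have hfull : N / κ * size κ i ≤ (hardSystem κ M N).count (σ.pre T) i := by
    rw [← h.value_mul_invDensity hs.isBest, ← pow_mul_invDensity hκ.ne', ← mul_assoc]
    have := h.one_le_invDensity (Nat.le_of_succ_le hkM)
    gcongr
    rw [div_mul_eq_mul_div, div_le_iff₀' hκ]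
    exact hs.le_value
  have hsum : N / κ * ∑ l ∈ Finset.range (i + 1), size κ l ≤
      ∑ l ∈ Finset.range (i + 1), ((hardSystem κ M N).count (σ.pre T') l : ℝ) := by
    refine le_trans ?_ (Finset.sum_le_sum fun l _ => hcount l)
    rw [Finset.sum_range_succ, Finset.sum_range_succ, mul_add]
    exact add_le_add hs.le_sum_count hfull
  have hvalue : N * κ ^ i ≤ κ * (hardSystem κ M N).value (σ.pre T') :=
    hs.le_value.trans <| mul_le_mul_of_nonneg_left (by exact_mod_cast value_mono hpre) hκ.le
  exact ⟨T', hT', hbest, hsum, h.le_value_of_isLastTime_succ hσ hiM hT' hbest hsum hvalue⟩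

theorem not_isCompetitive_solution (σ : Solution (HardSet κ M N)) :
    ¬ σ.IsCompetitive (hardSystem κ M N).toInstance α := by
  intro hσ
  have hstage : ∀ i ≤ M, ∃ T, IsStage κ M N σ i T := fun i => by
    induction i with
    | zero => exact fun _ => h.exists_isStage_zero hσ
    | succ i ih =>
      intro hi
      obtain ⟨T, hT⟩ := ih (i.le_succ.trans hi)
      exact h.exists_isStage_succ hσ hT hi
  obtain ⟨T, hT⟩ := hstage M le_rfl
  obtain ⟨-, k, hk, hkM, -, hlt⟩ := h.exists_isBest_succ_of_isStage hσ hT le_rfl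
  obtain rfl : k = M + 1 := le_antisymm hkM hk
  exact hlt.not_gt h.drop

end IsHard
end HardInstance

theorem exists_isHard {α κ : ℝ} (hα : 1 ≤ α) (hακ : α < κ) (hκ : 0 < sextic κ) :
    ∃ M N, IsHard κ α M N := by
  obtain ⟨M, hM⟩ := exists_isFirstDrop (hα.trans_lt hακ) hκ
  obtain ⟨N, hN⟩ := exists_nat_gt (κ / (κ - α))
  exact ⟨M, N, hM, hα, hακ, (div_lt_iff₀ (sub_pos.2 hακ)).1 hN⟩

theorem Algorithm.not_isCompetitive {α κ : ℝ} (hα : 1 ≤ α) (hακ : α < κ) (hκ : 0 < sextic κ)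
    (A : Algorithm) : ¬ A.IsCompetitive α := by
  obtain ⟨M, N, h⟩ := exists_isHard hα hακ hκ
  exact fun hA => h.not_isCompetitive_solution _ (hA (hardSystem κ M N).toInstance)

theorem le_competitiveRatio {ρ : ℝ}
    (h : ∀ α : ℝ, 1 ≤ α → α < ρ → ∀ A : Algorithm, ¬ A.IsCompetitive α) :
    (ρ : EReal) ≤ competitiveRatio := by
  refine le_iInf fun A => le_sInf ?_
  rintro _ ⟨α, hα, hA, rfl⟩
  exact EReal.coe_le_coe_iff.2 (not_lt.1 fun hlt => h α hα hlt A hA)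

theorem le_competitiveRatio_of_sextic_eq_zero {ρ : ℝ} (hρ : sextic ρ = 0) :
    (ρ : EReal) ≤ competitiveRatio :=
  le_competitiveRatio fun _ hα hαρ => by
    obtain ⟨κ, hακ, hκρ⟩ := exists_between hαρ
    exact Algorithm.not_isCompetitive hα hακ (sextic_pos_of_lt (hα.trans hακ.le) hκρ hρ.ge)

end IncMax

theorem mainTheorem1 :
    ∃ ρ : ℝ,
      (1 ≤ ρ ∧ -4 * ρ ^ 6 + 24 * ρ ^ 4 - ρ ^ 3 - 30 * ρ ^ 2 + 31 * ρ - 4 = 0) ∧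
      (∀ x : ℝ, 1 ≤ x → -4 * x ^ 6 + 24 * x ^ 4 - x ^ 3 - 30 * x ^ 2 + 31 * x - 4 = 0 → x = ρ) ∧
      (2.246 : ℝ) ≤ ρ ∧
      (ρ : EReal) ≤ IncMax.competitiveRatio := by
  obtain ⟨ρ, hρ, h0⟩ := IncMax.exists_sextic_root
  have h1 : 1 ≤ ρ := le_trans (by norm_num) hρ
  exact ⟨ρ, ⟨h1, h0⟩, fun x hx hx0 => IncMax.sextic_root_unique hx h1 hx0 h0, hρ,
    IncMax.le_competitiveRatio_of_sextic_eq_zero h0⟩
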